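/- **Proposition 3.5.** Let $(M_1,g_1,J)$ be a Kähler manifold, that is, a smooth Riemannian manifold with a smooth $(1,1)$-tensor field $J$ such that $J^2=-I$, $g_1(JX,JY)=g_1(X,Y)$ and $(\nabla_XJ)Y=0$ for all $X,Y\in\Gamma(TM_1)$, where $\nabla$ is the Levi-Civita connection of $g_1$. Let $(M_2,g_2)$ be a smooth Riemannian manifold and $F:M_1\to M_2$ a semi-invariant Riemannian submersion: $F$ is a smooth surjective map, its differential $F_*$ is surjective at every point and preserves the lengths of the vectors of $(\ker F_*)^\perp$, and there is a smooth distribution $\mathcal D_1\subseteq\ker F_*$ such that, with $\mathcal D_2$ the orthogonal complement of $\mathcal D_1$ in $\ker F_*$, $$\ker F_*=\mathcal D_1\oplus\mathcal D_2,\qquad J(\mathcal D_1)=\mathcal D_1,\qquad J(\mathcal D_2)\subseteq(\ker F_*)^\perp .$$ Let $\mu$ be the orthogonal complement of $J\mathcal D_2$ in $(\ker F_*)^\perp$. For $Z\in\Gamma((\ker F_*)^\perp)$ write $JZ=\mathcal BZ+\mathcal CZ$ with $\mathcal BZ\in\Gamma(\mathcal D_2)$ and $\mathcal CZ\in\Gamma(\mu)$.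 Let $\mathcal V$ and $\mathcal H$ be the orthogonal projections onto $\ker F_*$ and $(\ker F_*)^\perp$, and let $\mathcal A_XY=\mathcal H\nabla_{\mathcal HX}\mathcal VY+\mathcal V\nabla_{\mathcal HX}\mathcal HY$ be O'Neill's tensor. Then the distribution $(\ker F_*)^\perp$ defines a totally geodesic foliation (it is closed under the Lie bracket, and the second fundamental form of its leaves, $(Z_1,Z_2)\mapsto\mathcal V\nabla_{Z_1}Z_2$, vanishes) if and only if, for all $Z_1,Z_2\in\Gamma((\ker F_*)^\perp)$, $$\mathcal A_{Z_1}\mathcal BZ_2+\mathcal H\nabla_{Z_1}\mathcal CZ_2\in\Gamma(\mu)\qquad\text{and}\qquad \mathcal A_{Z_1}\mathcal CZ_2+\mathcal V\nabla_{Z_1}Z_2\in\Gamma(\mathcal D_2).$$ -/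

import Mathlib

open Bundle Manifold ContDiff

noncomputable section

section LeviCivita

variable {E : Type*} [NormedAddCommGroup E] [NormedSpace ℝ E]
  {M : Type*} [TopologicalSpace M] [ChartedSpace E M]

/-- Tangent spaces of a finite-dimensional manifold are finite-dimensional. -/
instance tangentSpace_finiteDimensional [FiniteDimensional ℝ E] (x : M) :
    FiniteDimensional ℝ (TangentSpace 𝓘(ℝ, E) x) :=
  inferInstanceAs (FiniteDimensional ℝ E)

variable [RiemannianBundle (fun x : M ↦ TangentSpace 𝓘(ℝ, E) x)] 

/-- The right-hand side of the Koszul formula for `2 g(∇_X Y, Z)`. -/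
def koszul (X Y Z : Π x : M, TangentSpace 𝓘(ℝ, E) x) (x : M) : ℝ :=
  mvfderiv 𝓘(ℝ, E) (fun y ↦ inner ℝ (Y y) (Z y)) x (X x)
    + mvfderiv 𝓘(ℝ, E) (fun y ↦ inner ℝ (Z y) (X y)) x (Y x)
    - mvfderiv 𝓘(ℝ, E) (fun y ↦ inner ℝ (X y) (Y y)) x (Z x)
    + inner ℝ (VectorField.mlieBracket 𝓘(ℝ, E) X Y x) (Z x)
    - inner ℝ (VectorField.mlieBracket 𝓘(ℝ, E) Y Z x) (X x)
    - inner ℝ (VectorField.mlieBracket 𝓘(ℝ, E) X Z x) (Y x)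

set_option linter.unusedSectionVars false

variable [IsManifold 𝓘(ℝ, E) ∞ M]
  [IsContMDiffRiemannianBundle 𝓘(ℝ, E) ∞ E (fun x : M ↦ TangentSpace 𝓘(ℝ, E) x)]

theorem mdiffAt_inner {X Y : Π x : M, TangentSpace 𝓘(ℝ, E) x} {x : M}
    (hX : MDiffAt (T% X) x) (hY : MDiffAt (T% Y) x) :
    MDiffAt (fun y ↦ inner ℝ (X y) (Y y)) x :=
  MDifferentiableAt.inner_bundle (IB := 𝓘(ℝ, E)) (F := E) (b := fun y ↦ y)
    (E := fun x : M ↦ TangentSpace 𝓘(ℝ, E) x) hX hY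

theorem mvfderiv_inner_add_left {X X' Y : Π x : M, TangentSpace 𝓘(ℝ, E) x} {x : M}
    (hX : MDiffAt (T% X) x) (hX' : MDiffAt (T% X') x) (hY : MDiffAt (T% Y) x) :
    mvfderiv 𝓘(ℝ, E) (fun y ↦ inner ℝ ((X + X') y) (Y y)) x =
      mvfderiv 𝓘(ℝ, E) (fun y ↦ inner ℝ (X y) (Y y)) x +
      mvfderiv 𝓘(ℝ, E) (fun y ↦ inner ℝ (X' y) (Y y)) x := by
  rw [← mvfderiv_fun_add (mdiffAt_inner hX hY) (mdiffAt_inner hX' hY)]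
  simp only [Pi.add_apply, inner_add_left]

theorem mvfderiv_inner_smul_left {f : M → ℝ} {X Y : Π x : M, TangentSpace 𝓘(ℝ, E) x} {x : M}
    (hf : MDiffAt f x) (hX : MDiffAt (T% X) x) (hY : MDiffAt (T% Y) x) :
    mvfderiv 𝓘(ℝ, E) (fun y ↦ inner ℝ ((f • X) y) (Y y)) x =
      f x • mvfderiv 𝓘(ℝ, E) (fun y ↦ inner ℝ (X y) (Y y)) x +
      inner ℝ (X x) (Y x) • mvfderiv 𝓘(ℝ, E) f x := by
  rw [← mvfderiv_fun_mul hf (mdiffAt_inner hX hY)]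
  simp only [Pi.smul_apply', real_inner_smul_left]

theorem mvfderiv_inner_comm (X Y : Π x : M, TangentSpace 𝓘(ℝ, E) x) (x : M) :
    mvfderiv 𝓘(ℝ, E) (fun y ↦ inner ℝ (X y) (Y y)) x =
      mvfderiv 𝓘(ℝ, E) (fun y ↦ inner ℝ (Y y) (X y)) x := by
  simp only [real_inner_comm]

variable [FiniteDimensional ℝ E]

theorem tensorialAt_koszul_left {Y Z : Π x : M, TangentSpace 𝓘(ℝ, E) x} {x : M}
    (hY : MDiffAt (T% Y) x) (hZ : MDiffAt (T% Z) x) :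
    TensorialAt 𝓘(ℝ, E) E (fun X ↦ koszul X Y Z x) x where
  smul {f X} hf hX := by
    simp only [koszul, VectorField.mlieBracket_smul_left hf hX, mvfderiv_inner_comm Z,
      mvfderiv_inner_smul_left hf hX hZ, mvfderiv_inner_smul_left hf hX hY]
    simp [inner_add_left, real_inner_smul_left, real_inner_smul_right, mvfderiv,
      real_inner_comm (X x)]
    ring
  add {X X'} hX hX' := by
    simp only [koszul, VectorField.mlieBracket_add_left hX hX', mvfderiv_inner_comm Z,
      mvfderiv_inner_add_left hX hX' hY, mvfderiv_inner_add_left hX hX' hZ]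
    simp [inner_add_left, inner_add_right]
    ring

theorem tensorialAt_koszul_right {X Y : Π x : M, TangentSpace 𝓘(ℝ, E) x} {x : M}
    (hX : MDiffAt (T% X) x) (hY : MDiffAt (T% Y) x) :
    TensorialAt 𝓘(ℝ, E) E (fun Z ↦ koszul X Y Z x) x where
  smul {f Z} hf hZ := by
    simp only [koszul, VectorField.mlieBracket_smul_right hf hZ, mvfderiv_inner_comm Y,
      mvfderiv_inner_smul_left hf hZ hX, mvfderiv_inner_smul_left hf hZ hY]
    simp [inner_add_left, real_inner_smul_left, real_inner_smul_right, mvfderiv,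
      real_inner_comm (Z x)]
    ring
  add {Z Z'} hZ hZ' := by
    simp only [koszul, VectorField.mlieBracket_add_right hZ hZ', mvfderiv_inner_comm Y,
      mvfderiv_inner_add_left hZ hZ' hX, mvfderiv_inner_add_left hZ hZ' hY]
    simp [inner_add_left, inner_add_right]
    ring

theorem koszul_add_middle {X Y Y' Z : Π x : M, TangentSpace 𝓘(ℝ, E) x} {x : M}
    (hX : MDiffAt (T% X) x) (hY : MDiffAt (T% Y) x) (hY' : MDiffAt (T% Y') x)
    (hZ : MDiffAt (T% Z) x) :
    koszul X (Y + Y') Z x = koszul X Y Z x + koszul X Y' Z x := by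
  simp only [koszul, VectorField.mlieBracket_add_right hY hY',
    VectorField.mlieBracket_add_left hY hY', mvfderiv_inner_comm X,
    mvfderiv_inner_add_left hY hY' hX, mvfderiv_inner_add_left hY hY' hZ]
  simp [inner_add_left, inner_add_right]
  ring

theorem koszul_smul_middle {f : M → ℝ} {X Y Z : Π x : M, TangentSpace 𝓘(ℝ, E) x} {x : M}
    (hf : MDiffAt f x) (hX : MDiffAt (T% X) x) (hY : MDiffAt (T% Y) x)
    (hZ : MDiffAt (T% Z) x) :
    koszul X (f • Y) Z x =
      f x * koszul X Y Z x + 2 * (mvfderiv 𝓘(ℝ, E) f x (X x) * inner ℝ (Y x) (Z x)) := by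
  simp only [koszul, VectorField.mlieBracket_smul_right hf hY,
    VectorField.mlieBracket_smul_left hf hY, mvfderiv_inner_comm X,
    mvfderiv_inner_smul_left hf hY hX, mvfderiv_inner_smul_left hf hY hZ]
  simp [inner_add_left, real_inner_smul_left, real_inner_smul_right, mvfderiv,
      real_inner_comm (Y x)]
  ring

/-- For a vector field `Y` differentiable at `x`, the bilinear form `(v, w) ↦ 2 g(∇_v Y, w)` on the
tangent space at `x`, given by the Koszul formula. -/
def leviCivitaForm (Y : Π x : M, TangentSpace 𝓘(ℝ, E) x) (x : M) (hY : MDiffAt (T% Y) x) :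
    TangentSpace 𝓘(ℝ, E) x →L[ℝ] TangentSpace 𝓘(ℝ, E) x →L[ℝ] ℝ :=
  TensorialAt.mkHom₂ (I := 𝓘(ℝ, E)) (F := E) (F' := E) (fun X Z ↦ koszul X Y Z x) x
    (fun _ hZ ↦ tensorialAt_koszul_left hY hZ) (fun _ hX ↦ tensorialAt_koszul_right hX hY)

open Classical in
/-- The Levi-Civita connection as a bare function: `∇_v Y` is the vector with
`2 g(∇_v Y, Z) = koszul X Y Z`, where `X` extends `v` (and zero where `Y` is not
differentiable). -/
def leviCivitaAux (Y : Π x : M, TangentSpace 𝓘(ℝ, E) x) (x : M) :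
    TangentSpace 𝓘(ℝ, E) x →L[ℝ] TangentSpace 𝓘(ℝ, E) x :=
  haveI : CompleteSpace (TangentSpace 𝓘(ℝ, E) x) := FiniteDimensional.complete ℝ _
  if hY : MDiffAt (T% Y) x then
    (1 / 2 : ℝ) • InnerProductSpace.continuousLinearMapOfBilin (𝕜 := ℝ) (leviCivitaForm Y x hY)
  else 0

theorem inner_leviCivitaAux {X Y Z : Π x : M, TangentSpace 𝓘(ℝ, E) x} {x : M}
    (hX : MDiffAt (T% X) x) (hY : MDiffAt (T% Y) x) (hZ : MDiffAt (T% Z) x) :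
    2 * inner ℝ (leviCivitaAux Y x (X x)) (Z x) = koszul X Y Z x := by
  have : CompleteSpace (TangentSpace 𝓘(ℝ, E) x) := FiniteDimensional.complete ℝ _
  have h := InnerProductSpace.continuousLinearMapOfBilin_apply (𝕜 := ℝ)
    (leviCivitaForm Y x hY) (X x) (Z x)
  have h2 : leviCivitaForm Y x hY (X x) (Z x) = koszul X Y Z x :=
    TensorialAt.mkHom₂_apply _ _ hX hZ
  rw [leviCivitaAux, dif_pos hY, smul_apply, real_inner_smul_left]
  rw [h2] at h
  linarith

theorem eq_of_inner_fields {x : M} {u v : TangentSpace 𝓘(ℝ, E) x}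
    (h : ∀ Z : Π x : M, TangentSpace 𝓘(ℝ, E) x, MDiffAt (T% Z) x →
      2 * inner ℝ u (Z x) = 2 * inner ℝ v (Z x)) : u = v := by
  refine ext_inner_right ℝ fun w ↦ ?_
  have := h (FiberBundle.extend E w) (FiberBundle.mdifferentiableAt_extend ..)
  simp at this
  exact this

/-- The Levi-Civita connection of a smooth Riemannian metric: `leviCivita Y x v` is `(∇_v Y)(x)`. -/
def leviCivita : CovariantDerivative 𝓘(ℝ, E) E (fun x : M ↦ TangentSpace 𝓘(ℝ, E) x) where
  toFun := leviCivitaAux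
  isCovariantDerivativeOnUniv :=
    { add {Y Y' x} hY hY' _ := by
        ext v
        obtain ⟨X, hX, rfl⟩ : ∃ X : Π x : M, TangentSpace 𝓘(ℝ, E) x, MDiffAt (T% X) x ∧ X x = v :=
          ⟨FiberBundle.extend E v, FiberBundle.mdifferentiableAt_extend .., by simp⟩
        refine eq_of_inner_fields fun Z hZ ↦ ?_
        rw [inner_leviCivitaAux hX (mdifferentiableAt_add_section hY hY') hZ,
          koszul_add_middle hX hY hY' hZ, add_apply, inner_add_left, mul_add,
          inner_leviCivitaAux hX hY hZ, inner_leviCivitaAux hX hY' hZ]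
      leibniz {Y f x} hY hf _ := by
        ext v
        obtain ⟨X, hX, rfl⟩ : ∃ X : Π x : M, TangentSpace 𝓘(ℝ, E) x, MDiffAt (T% X) x ∧ X x = v :=
          ⟨FiberBundle.extend E v, FiberBundle.mdifferentiableAt_extend .., by simp⟩
        refine eq_of_inner_fields fun Z hZ ↦ ?_
        rw [inner_leviCivitaAux hX (hf.smul_section hY) hZ,
          koszul_smul_middle hf hX hY hZ, add_apply, inner_add_left, mul_add,
          smul_apply, real_inner_smul_left, ContinuousLinearMap.smulRight_apply,
          real_inner_smul_left, ← inner_leviCivitaAux hX hY hZ]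
        ring }

/-- The Levi-Civita connection is torsion free. -/
theorem leviCivita_torsion {X Y : Π x : M, TangentSpace 𝓘(ℝ, E) x} {x : M}
    (hX : MDiffAt (T% X) x) (hY : MDiffAt (T% Y) x) :
    leviCivita Y x (X x) - leviCivita X x (Y x) = VectorField.mlieBracket 𝓘(ℝ, E) X Y x := by
  refine eq_of_inner_fields fun Z hZ ↦ ?_
  have h₁ : _ = koszul X Y Z x := inner_leviCivitaAux hX hY hZ
  have h₂ : _ = koszul Y X Z x := inner_leviCivitaAux hY hX hZ
  have h₃ : VectorField.mlieBracket 𝓘(ℝ, E) Y X x = -VectorField.mlieBracket 𝓘(ℝ, E) X Y x :=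
    VectorField.mlieBracket_swap_apply
  change 2 * inner ℝ (leviCivitaAux Y x (X x) - leviCivitaAux X x (Y x)) (Z x) = _
  rw [inner_sub_left, mul_sub, h₁, h₂]
  simp only [koszul, h₃, inner_neg_left]
  rw [mvfderiv_inner_comm Y Z, mvfderiv_inner_comm Z X, mvfderiv_inner_comm X Y]
  ring

/-- The Levi-Civita connection is compatible with the metric. -/
theorem leviCivita_metric {X Y Z : Π x : M, TangentSpace 𝓘(ℝ, E) x} {x : M}
    (hX : MDiffAt (T% X) x) (hY : MDiffAt (T% Y) x) (hZ : MDiffAt (T% Z) x) :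
    mvfderiv 𝓘(ℝ, E) (fun y ↦ inner ℝ (Y y) (Z y)) x (X x) =
      inner ℝ (leviCivita Y x (X x)) (Z x) + inner ℝ (Y x) (leviCivita Z x (X x)) := by
  have h₁ : _ = koszul X Y Z x := inner_leviCivitaAux hX hY hZ
  have h₂ : _ = koszul X Z Y x := inner_leviCivitaAux hX hZ hY
  have h₃ : VectorField.mlieBracket 𝓘(ℝ, E) Z Y x = -VectorField.mlieBracket 𝓘(ℝ, E) Y Z x :=
    VectorField.mlieBracket_swap_apply
  change _ = inner ℝ (leviCivitaAux Y x (X x)) (Z x) + inner ℝ (Y x) (leviCivitaAux Z x (X x))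
  rw [real_inner_comm _ (Y x)]
  simp only [koszul, h₃, inner_neg_left] at h₁ h₂
  rw [mvfderiv_inner_comm Z Y, mvfderiv_inner_comm Y X, mvfderiv_inner_comm X Z] at h₂
  linarith

end LeviCivita

section Fields

variable {E : Type*} [NormedAddCommGroup E] [NormedSpace ℝ E]
  {M : Type*} [TopologicalSpace M] [ChartedSpace E M]

/-- A vector field of class `C^∞` on `M`. -/
def IsSmoothField [IsManifold 𝓘(ℝ, E) ∞ M] (X : Π x : M, TangentSpace 𝓘(ℝ, E) x) : Prop :=
  ContMDiff 𝓘(ℝ, E) (𝓘(ℝ, E).prod 𝓘(ℝ, E)) ∞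
    (fun x ↦ TotalSpace.mk' E (E := fun x : M ↦ TangentSpace 𝓘(ℝ, E) x) x (X x))

/-- `Γ(D)`: the smooth vector fields with values in `D`. -/
def smoothSections [IsManifold 𝓘(ℝ, E) ∞ M]
    (D : Π x : M, Submodule ℝ (TangentSpace 𝓘(ℝ, E) x)) :
    Set (Π x : M, TangentSpace 𝓘(ℝ, E) x) :=
  {X | IsSmoothField X ∧ ∀ x, X x ∈ D x}

/-- A smooth distribution (a smooth subbundle of the tangent bundle): near every point, `D` has a
smooth frame. -/
def IsSmoothDistribution [IsManifold 𝓘(ℝ, E) ∞ M]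
    (D : Π x : M, Submodule ℝ (TangentSpace 𝓘(ℝ, E) x)) : Prop :=
  ∀ x : M, ∃ U : Set M, IsOpen U ∧ x ∈ U ∧
    ∃ (k : ℕ) (X : Fin k → Π y : M, TangentSpace 𝓘(ℝ, E) y),
      (∀ i, ContMDiffOn 𝓘(ℝ, E) (𝓘(ℝ, E).prod 𝓘(ℝ, E)) ∞
        (fun y ↦ TotalSpace.mk' E (E := fun y : M ↦ TangentSpace 𝓘(ℝ, E) y) y (X i y)) U) ∧
      ∀ y ∈ U, LinearIndependent ℝ (fun i ↦ X i y) ∧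
        D y = Submodule.span ℝ (Set.range fun i ↦ X i y)

/-- A distribution `D` is involutive, i.e. tangent to a foliation, if `Γ(D)` is closed under the
Lie bracket. -/
def IsInvolutive [IsManifold 𝓘(ℝ, E) ∞ M]
    (D : Π x : M, Submodule ℝ (TangentSpace 𝓘(ℝ, E) x)) : Prop :=
  ∀ X ∈ smoothSections D, ∀ Y ∈ smoothSections D, ∀ x,
    VectorField.mlieBracket 𝓘(ℝ, E) X Y x ∈ D x

end Fields

section Hermitian

variable {E : Type*} [NormedAddCommGroup E] [NormedSpace ℝ E] [FiniteDimensional ℝ E]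
  {M : Type*} [TopologicalSpace M] [ChartedSpace E M] [IsManifold 𝓘(ℝ, E) ∞ M]
  [RiemannianBundle (fun x : M ↦ TangentSpace 𝓘(ℝ, E) x)]
  [IsContMDiffRiemannianBundle 𝓘(ℝ, E) ∞ E (fun x : M ↦ TangentSpace 𝓘(ℝ, E) x)]

/-- `h(X, Y) = (∇_X Y)^⊥`, the component of `∇_X Y` orthogonal to `D`. For an involutive
distribution `D` and `X, Y ∈ Γ(D)`, this is the second fundamental form of the leaves of `D`. -/
def secondFundamentalForm (D : Π x : M, Submodule ℝ (TangentSpace 𝓘(ℝ, E) x))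
    (X Y : Π x : M, TangentSpace 𝓘(ℝ, E) x) (x : M) : TangentSpace 𝓘(ℝ, E) x :=
  (D x)ᗮ.starProjection (leviCivita Y x (X x))

/-- The smooth distribution `D` defines a totally geodesic foliation: it is involutive, and the
second fundamental form of its leaves vanishes. -/
structure IsTotallyGeodesicFoliation (D : Π x : M, Submodule ℝ (TangentSpace 𝓘(ℝ, E) x)) :
    Prop where
  involutive : IsInvolutive D
  totallyGeodesic : ∀ X ∈ smoothSections D, ∀ Y ∈ smoothSections D, ∀ x,
    secondFundamentalForm D X Y x = 0

/-- `(M, g, J)` is an almost Hermitian manifold: `J` is a smooth `(1, 1)` tensor field with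
`J² = -I` and `g(JX, JY) = g(X, Y)`. -/
structure IsAlmostHermitian
    (J : Π x : M, TangentSpace 𝓘(ℝ, E) x →L[ℝ] TangentSpace 𝓘(ℝ, E) x) : Prop where
  smooth : ContMDiff 𝓘(ℝ, E) (𝓘(ℝ, E).prod 𝓘(ℝ, E →L[ℝ] E)) ∞
    (fun x ↦ TotalSpace.mk' (E →L[ℝ] E)
      (E := fun x : M ↦ TangentSpace 𝓘(ℝ, E) x →L[ℝ] TangentSpace 𝓘(ℝ, E) x) x (J x))
  sq_eq_neg : ∀ x (v : TangentSpace 𝓘(ℝ, E) x), J x (J x v) = -v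
  inner_map_map : ∀ x (v w : TangentSpace 𝓘(ℝ, E) x), inner ℝ (J x v) (J x w) = inner ℝ v w

/-- `(M, g, J)` is a Kähler manifold: it is almost Hermitian, and
`(∇_X J) Y = ∇_X (J Y) - J (∇_X Y)` vanishes for all smooth vector fields `X` and `Y`. -/
structure IsKahler (J : Π x : M, TangentSpace 𝓘(ℝ, E) x →L[ℝ] TangentSpace 𝓘(ℝ, E) x) : Prop
    extends IsAlmostHermitian J where
  parallel : ∀ X Y : Π x : M, TangentSpace 𝓘(ℝ, E) x, IsSmoothField X → IsSmoothField Y → ∀ x,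
    leviCivita (fun y ↦ J y (Y y)) x (X x) - J x (leviCivita Y x (X x)) = 0

end Hermitian

section Submersion

set_option linter.unusedSectionVars false

variable {E₁ E₂ : Type*} [NormedAddCommGroup E₁] [NormedSpace ℝ E₁] [FiniteDimensional ℝ E₁]
  [NormedAddCommGroup E₂] [NormedSpace ℝ E₂]
  {M₁ M₂ : Type*} [TopologicalSpace M₁] [ChartedSpace E₁ M₁] [IsManifold 𝓘(ℝ, E₁) ∞ M₁]
  [TopologicalSpace M₂] [ChartedSpace E₂ M₂]
  [RiemannianBundle (fun x : M₁ ↦ TangentSpace 𝓘(ℝ, E₁) x)]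
  [IsContMDiffRiemannianBundle 𝓘(ℝ, E₁) ∞ E₁ (fun x : M₁ ↦ TangentSpace 𝓘(ℝ, E₁) x)]
  [RiemannianBundle (fun x : M₂ ↦ TangentSpace 𝓘(ℝ, E₂) x)]

variable (E₁ E₂) in
/-- The vertical distribution `ker F_*`. -/
def vertical (F : M₁ → M₂) (x : M₁) : Submodule ℝ (TangentSpace 𝓘(ℝ, E₁) x) :=
  LinearMap.ker (mfderiv 𝓘(ℝ, E₁) 𝓘(ℝ, E₂) F x).toLinearMap

variable (E₁ E₂) in
/-- The horizontal distribution `(ker F_*)^⊥`. -/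
def horizontal (F : M₁ → M₂) (x : M₁) : Submodule ℝ (TangentSpace 𝓘(ℝ, E₁) x) :=
  (vertical E₁ E₂ F x)ᗮ

variable (E₁ E₂) in
/-- `F` is a Riemannian submersion: a smooth map onto `M₂` whose differential has maximal rank
and preserves the length of horizontal vectors. -/
structure IsRiemannianSubmersion [IsManifold 𝓘(ℝ, E₂) ∞ M₂] (F : M₁ → M₂) : Prop where
  smooth : ContMDiff 𝓘(ℝ, E₁) 𝓘(ℝ, E₂) ∞ F
  surjective : Function.Surjective F
  surjective_mfderiv : ∀ x, Function.Surjective (mfderiv 𝓘(ℝ, E₁) 𝓘(ℝ, E₂) F x)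
  norm_mfderiv : ∀ x, ∀ v ∈ horizontal E₁ E₂ F x, ‖mfderiv 𝓘(ℝ, E₁) 𝓘(ℝ, E₂) F x v‖ = ‖v‖

variable (E₂) in
/-- The vertical projection `𝒱`. -/
def vProj (F : M₁ → M₂) (x : M₁) : TangentSpace 𝓘(ℝ, E₁) x →L[ℝ] TangentSpace 𝓘(ℝ, E₁) x :=
  (vertical E₁ E₂ F x).starProjection

variable (E₂) in
/-- The horizontal projection `ℋ`. -/
def hProj (F : M₁ → M₂) (x : M₁) : TangentSpace 𝓘(ℝ, E₁) x →L[ℝ] TangentSpace 𝓘(ℝ, E₁) x :=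
  (horizontal E₁ E₂ F x).starProjection

variable (E₂) in
/-- O'Neill's tensor `𝒜_X Y = ℋ ∇_{ℋX} (𝒱Y) + 𝒱 ∇_{ℋX} (ℋY)`. -/
def oneillA (F : M₁ → M₂) (X Y : Π x : M₁, TangentSpace 𝓘(ℝ, E₁) x) (x : M₁) :
    TangentSpace 𝓘(ℝ, E₁) x :=
  hProj E₂ F x (leviCivita (fun y ↦ vProj E₂ F y (Y y)) x (hProj E₂ F x (X x)))
    + vProj E₂ F x (leviCivita (fun y ↦ hProj E₂ F y (Y y)) x (hProj E₂ F x (X x)))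

variable (E₂) in
/-- `𝒟₂`, the orthogonal complement of `𝒟₁` in `ker F_*`. -/
def distD₂ (F : M₁ → M₂) (D₁ : Π x : M₁, Submodule ℝ (TangentSpace 𝓘(ℝ, E₁) x)) (x : M₁) :
    Submodule ℝ (TangentSpace 𝓘(ℝ, E₁) x) :=
  vertical E₁ E₂ F x ⊓ (D₁ x)ᗮ

variable (E₂) in
/-- `μ`, the orthogonal complement of `J 𝒟₂` in `(ker F_*)^⊥`. -/
def distμ (J : Π x : M₁, TangentSpace 𝓘(ℝ, E₁) x →L[ℝ] TangentSpace 𝓘(ℝ, E₁) x) (F : M₁ → M₂)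
    (D₁ : Π x : M₁, Submodule ℝ (TangentSpace 𝓘(ℝ, E₁) x)) (x : M₁) :
    Submodule ℝ (TangentSpace 𝓘(ℝ, E₁) x) :=
  horizontal E₁ E₂ F x ⊓ ((distD₂ E₂ F D₁ x).map (J x).toLinearMap)ᗮ

variable (E₂) in
/-- `F` is a semi-invariant Riemannian submersion with invariant vertical distribution `𝒟₁`:
`𝒟₁ ⊆ ker F_*` is a distribution with `J 𝒟₁ = 𝒟₁`, and `J 𝒟₂ ⊆ (ker F_*)^⊥` for its orthogonal
complement `𝒟₂` in `ker F_*`. -/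
structure IsSemiInvariantSubmersion [IsManifold 𝓘(ℝ, E₂) ∞ M₂]
    (J : Π x : M₁, TangentSpace 𝓘(ℝ, E₁) x →L[ℝ] TangentSpace 𝓘(ℝ, E₁) x) (F : M₁ → M₂)
    (D₁ : Π x : M₁, Submodule ℝ (TangentSpace 𝓘(ℝ, E₁) x)) : Prop
    extends IsRiemannianSubmersion E₁ E₂ F where
  smoothDistribution : IsSmoothDistribution D₁
  le_vertical : ∀ x, D₁ x ≤ vertical E₁ E₂ F x
  map_D₁ : ∀ x, (D₁ x).map (J x).toLinearMap = D₁ x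
  map_D₂_le : ∀ x, (distD₂ E₂ F D₁ x).map (J x).toLinearMap ≤ horizontal E₁ E₂ F x

variable (E₂) in
/-- `ℬZ`, the component of `JZ` in `𝒟₂`. For horizontal `Z`, `JZ = ℬZ + 𝒞Z`
(see `map_eq_fieldB_add_fieldC`). -/
def fieldB (J : Π x : M₁, TangentSpace 𝓘(ℝ, E₁) x →L[ℝ] TangentSpace 𝓘(ℝ, E₁) x) (F : M₁ → M₂)
    (D₁ : Π x : M₁, Submodule ℝ (TangentSpace 𝓘(ℝ, E₁) x))
    (Z : Π x : M₁, TangentSpace 𝓘(ℝ, E₁) x) (x : M₁) : TangentSpace 𝓘(ℝ, E₁) x :=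
  (distD₂ E₂ F D₁ x).starProjection (J x (Z x))

variable (E₂) in
/-- `𝒞Z`, the component of `JZ` in `μ`. -/
def fieldC (J : Π x : M₁, TangentSpace 𝓘(ℝ, E₁) x →L[ℝ] TangentSpace 𝓘(ℝ, E₁) x) (F : M₁ → M₂)
    (D₁ : Π x : M₁, Submodule ℝ (TangentSpace 𝓘(ℝ, E₁) x))
    (Z : Π x : M₁, TangentSpace 𝓘(ℝ, E₁) x) (x : M₁) : TangentSpace 𝓘(ℝ, E₁) x :=
  (distμ E₂ J F D₁ x).starProjection (J x (Z x))

/-- The decomposition `JZ = ℬZ + 𝒞Z` of a horizontal vector field `Z`. -/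
theorem map_eq_fieldB_add_fieldC [IsManifold 𝓘(ℝ, E₂) ∞ M₂]
    {J : Π x : M₁, TangentSpace 𝓘(ℝ, E₁) x →L[ℝ] TangentSpace 𝓘(ℝ, E₁) x} {F : M₁ → M₂}
    {D₁ : Π x : M₁, Submodule ℝ (TangentSpace 𝓘(ℝ, E₁) x)} (hJ : IsAlmostHermitian J)
    (hF : IsSemiInvariantSubmersion E₂ J F D₁) {Z : Π x : M₁, TangentSpace 𝓘(ℝ, E₁) x} {x : M₁}
    (hZ : Z x ∈ horizontal E₁ E₂ F x) :
    J x (Z x) = fieldB E₂ J F D₁ Z x + fieldC E₂ J F D₁ Z x := by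
  set K := distD₂ E₂ F D₁ x
  have hadj : ∀ v w : TangentSpace 𝓘(ℝ, E₁) x, inner ℝ (J x v) w = -inner ℝ v (J x w) := by
    intro v w
    rw [← hJ.inner_map_map x v (J x w), hJ.sq_eq_neg, inner_neg_right, neg_neg]
  have hsub : J x (Z x) - K.starProjection (J x (Z x)) ∈ Kᗮ :=
    Submodule.sub_starProjection_mem_orthogonal _
  have hP : K.starProjection (J x (Z x)) ∈ K := Submodule.starProjection_apply_mem _ _
  -- `JZ - ℬZ` is orthogonal to `𝒟₁`
  have h₁ : J x (Z x) - K.starProjection (J x (Z x)) ∈ (D₁ x)ᗮ := by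
    refine Submodule.sub_mem _ ?_ hP.2
    rw [Submodule.mem_orthogonal']
    intro u hu
    rw [hadj, Submodule.inner_left_of_mem_orthogonal (K := vertical E₁ E₂ F x) _ hZ, neg_zero]
    apply hF.le_vertical x
    rw [← hF.map_D₁ x]
    exact Submodule.mem_map_of_mem hu
  have h₂ : J x (Z x) - K.starProjection (J x (Z x)) ∈ horizontal E₁ E₂ F x := by
    rw [horizontal, Submodule.mem_orthogonal']
    intro u hu
    have hu₁ : (D₁ x).starProjection u ∈ D₁ x := Submodule.starProjection_apply_mem _ _
    have hu₂ : u - (D₁ x).starProjection u ∈ K :=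
      ⟨Submodule.sub_mem _ hu (hF.le_vertical x hu₁),
        Submodule.sub_starProjection_mem_orthogonal _⟩
    have hdec : u = (D₁ x).starProjection u + (u - (D₁ x).starProjection u) := by abel
    rw [hdec, inner_add_right, Submodule.inner_left_of_mem_orthogonal hu₁ h₁,
      Submodule.inner_left_of_mem_orthogonal hu₂ hsub, add_zero]
  have h₃ : J x (Z x) - K.starProjection (J x (Z x)) ∈ distμ E₂ J F D₁ x := by
    refine ⟨h₂, (Submodule.mem_orthogonal' _ _).2 ?_⟩
    rintro _ ⟨d, hd, rfl⟩
    change inner ℝ _ (J x d) = 0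
    have h₀ : inner ℝ (K.starProjection (J x (Z x))) (J x d) = 0 :=
      Submodule.inner_right_of_mem_orthogonal hP.1
        (hF.map_D₂_le x (Submodule.mem_map_of_mem hd))
    rw [inner_sub_left, hJ.inner_map_map, Submodule.inner_left_of_mem_orthogonal hd.1 hZ, h₀,
      sub_zero]
  have h₄ : K.starProjection (J x (Z x)) ∈ (distμ E₂ J F D₁ x)ᗮ := by
    rw [Submodule.mem_orthogonal']
    intro u hu
    exact Submodule.inner_right_of_mem_orthogonal hP.1 hu.1
  have h₅ : fieldC E₂ J F D₁ Z x = J x (Z x) - K.starProjection (J x (Z x)) := by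
    refine Submodule.eq_starProjection_of_mem_orthogonal h₃ ?_
    simpa using h₄
  rw [h₅]
  change _ = K.starProjection (J x (Z x)) + _
  abel

end Submersion

end

/-! Write `f Z` for the vertical part of ∇_{Z₁} Z at a point. Since the Levi-Civita connection is
torsion free, vanishing of `f` on all horizontal fields already gives involutivity, so the claim
concerns `f` alone (`isTotallyGeodesicFoliation_horizontal_iff`).

Because J is parallel, the first expression is the horizontal part of J∇_{Z₁}Z₂. As J is an isometry
and J𝒟₂ is horizontal, it lies in μ exactly when ∇_{Z₁}Z₂ ⟂ 𝒟₂ (`oneillA_fieldB_add_hProj`,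
`hProj_map_mem_distμ_iff`). The second expression is f(𝒞Z₂) + f(Z₂). If `f` vanishes, both
conditions are immediate.

Conversely, the second condition says f(𝒞Z) ≡ -f(Z) modulo 𝒟₂ for every horizontal Z. Applying it
twice gives f(𝒞²Z) ≡ f(Z). But Q = Z + 𝒞²Z = -JℬZ satisfies 𝒞Q = 0, so applying it to Q gives f(Z) +
f(𝒞²Z) ≡ 0. Hence 2f(Z) ∈ 𝒟₂, while the first condition puts f(Z) in 𝒟₂^⊥, so f(Z) = 0.

The analytic point is that 𝒞Z and 𝒞²Z must be smooth for the hypothesis to apply to them. On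
horizontal fields 𝒞 = ℋJ, so it suffices that ℋ preserves smoothness (`isSmoothField_hProj`). In
coordinates ℋ is obtained by solving a linear system with smooth invertible coefficients. -/

/-! ### Linear algebra: orthogonal projection by Lagrange multipliers -/

section SaddlePoint

variable {E F : Type*} [NormedAddCommGroup E] [NormedSpace ℝ E]
  [NormedAddCommGroup F] [NormedSpace ℝ F]

/-- The operator `(h, l) ↦ (G h + l ∘ A, A h)`. If `G` is an inner product, then the solution of
`saddleOperator G A (h, l) = (0, A v)` is the component `h` of `v` orthogonal to `ker A`. -/
noncomputable def saddleOperator (G : E →L[ℝ] E →L[ℝ] ℝ) (A : E →L[ℝ] F) :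
    E × (F →L[ℝ] ℝ) →L[ℝ] (E →L[ℝ] ℝ) × F :=
  ContinuousLinearMap.inl ℝ (E →L[ℝ] ℝ) F ∘L G ∘L ContinuousLinearMap.fst ℝ E (F →L[ℝ] ℝ)
    + ContinuousLinearMap.inl ℝ (E →L[ℝ] ℝ) F ∘L
      (ContinuousLinearMap.compL ℝ E F ℝ).flip A ∘L ContinuousLinearMap.snd ℝ E (F →L[ℝ] ℝ)
    + ContinuousLinearMap.inr ℝ (E →L[ℝ] ℝ) F ∘L A ∘L ContinuousLinearMap.fst ℝ E (F →L[ℝ] ℝ)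

theorem saddleOperator_apply (G : E →L[ℝ] E →L[ℝ] ℝ) (A : E →L[ℝ] F) (p : E × (F →L[ℝ] ℝ)) :
    saddleOperator G A p = (G p.1 + p.2 ∘L A, A p.1) := by
  simp [saddleOperator]

theorem contDiff_saddleOperator :
    ContDiff ℝ ∞ (fun p : (E →L[ℝ] E →L[ℝ] ℝ) × (E →L[ℝ] F) ↦ saddleOperator p.1 p.2) := by
  unfold saddleOperator
  fun_prop

/-- Positivity of `G` kills the vector in the kernel, surjectivity of `A` then kills the multiplier,
and equality of dimensions upgrades injectivity to invertibility. -/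
theorem isInvertible_saddleOperator [FiniteDimensional ℝ E] [FiniteDimensional ℝ F]
    {G : E →L[ℝ] E →L[ℝ] ℝ} {A : E →L[ℝ] F} (hG : ∀ v, v ≠ 0 → 0 < G v v)
    (hA : Function.Surjective A) : (saddleOperator G A).IsInvertible := by
  have hinj : Function.Injective (saddleOperator G A).toLinearMap := by
    rw [← LinearMap.ker_eq_bot, LinearMap.ker_eq_bot']
    rintro ⟨h, l⟩ hp
    replace hp : saddleOperator G A (h, l) = 0 := hp
    simp only [saddleOperator_apply, Prod.mk_eq_zero] at hp
    obtain ⟨h₁, h₂⟩ := hp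
    have h₀ : h = 0 := by
      by_contra hne
      -- Evaluated at `h`, the multiplier term is l(A h) = 0, leaving G h h = 0.
      have := DFunLike.congr_fun h₁ h
      simp [h₂] at this
      exact (hG h hne).ne' this
    subst h₀
    refine Prod.ext rfl (ContinuousLinearMap.ext fun w ↦ ?_)
    obtain ⟨v, rfl⟩ := hA w
    simpa using DFunLike.congr_fun h₁ v
  have hrank : Module.finrank ℝ (E × (F →L[ℝ] ℝ)) = Module.finrank ℝ ((E →L[ℝ] ℝ) × F) := by
    rw [Module.finrank_prod, Module.finrank_prod,
      ← (LinearMap.toContinuousLinearMap (𝕜 := ℝ) (E := E) (F' := ℝ)).finrank_eq,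
      ← (LinearMap.toContinuousLinearMap (𝕜 := ℝ) (E := F) (F' := ℝ)).finrank_eq,
      Module.finrank_linearMap_self, Module.finrank_linearMap_self]
  exact ⟨(LinearEquiv.ofInjectiveOfFinrankEq _ hinj hrank).toContinuousLinearEquiv,
    ContinuousLinearMap.ext fun _ ↦ rfl⟩

end SaddlePoint

/-! ### Smoothness of the horizontal projection -/

section HorizontalProjection

variable {E₁ E₂ : Type*} [NormedAddCommGroup E₁] [NormedSpace ℝ E₁] [FiniteDimensional ℝ E₁]
  [NormedAddCommGroup E₂] [NormedSpace ℝ E₂] [FiniteDimensional ℝ E₂]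
  {M₁ M₂ : Type*} [TopologicalSpace M₁] [ChartedSpace E₁ M₁] [IsManifold 𝓘(ℝ, E₁) ∞ M₁]
  [TopologicalSpace M₂] [ChartedSpace E₂ M₂] [IsManifold 𝓘(ℝ, E₂) ∞ M₂]
  [RiemannianBundle (fun x : M₁ ↦ TangentSpace 𝓘(ℝ, E₁) x)]
  [IsContMDiffRiemannianBundle 𝓘(ℝ, E₁) ∞ E₁ (fun x : M₁ ↦ TangentSpace 𝓘(ℝ, E₁) x)]

/-- The horizontal part of a smooth vector field is smooth. -/
theorem isSmoothField_hProj {F : M₁ → M₂} (hF : ContMDiff 𝓘(ℝ, E₁) 𝓘(ℝ, E₂) ∞ F)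
    (hsurj : ∀ x, Function.Surjective (mfderiv 𝓘(ℝ, E₁) 𝓘(ℝ, E₂) F x))
    {X : Π x : M₁, TangentSpace 𝓘(ℝ, E₁) x} (hX : IsSmoothField X) :
    IsSmoothField (fun x ↦ hProj E₂ F x (X x)) := by
  intro x₀
  obtain ⟨g, hg, hgi⟩ := IsContMDiffRiemannianBundle.exists_contMDiff (IB := 𝓘(ℝ, E₁)) (n := ∞)
    (F := E₁) (E := fun x : M₁ ↦ TangentSpace 𝓘(ℝ, E₁) x)
  have hA := (hF x₀).mfderiv_const (m := ∞) (by simp)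
  have hG := ((contMDiffAt_hom_bundle _).1 (hg x₀)).2
  have hXx := (contMDiffAt_section x₀).1 (hX x₀)
  rw [contMDiffAt_section]
  set t := trivializationAt E₁ (fun x : M₁ ↦ TangentSpace 𝓘(ℝ, E₁) x) x₀
  set t₂ := trivializationAt E₂ (fun x : M₂ ↦ TangentSpace 𝓘(ℝ, E₂) x) (F x₀)
  set A := inTangentCoordinates 𝓘(ℝ, E₁) 𝓘(ℝ, E₂) id F (mfderiv 𝓘(ℝ, E₁) 𝓘(ℝ, E₂) F) x₀
  simp only at hG
  set G : M₁ → E₁ →L[ℝ] E₁ →L[ℝ] ℝ := fun x ↦ ContinuousLinearMap.inCoordinates E₁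
    (fun x : M₁ ↦ TangentSpace 𝓘(ℝ, E₁) x) (E₁ →L[ℝ] ℝ)
    (fun x : M₁ ↦ TangentSpace 𝓘(ℝ, E₁) x →L[ℝ] ℝ) x₀ x x₀ x (g x)
  -- `A` and `G` are the differential of `F` and the metric read in the trivializations around `x₀`
  -- and `F x₀`; both are smooth at `x₀`.
  have hGapp : ∀ x ∈ t.baseSet, ∀ v w : E₁, G x v w = inner ℝ (t.symm x v) (t.symm x w) := by
    intro x hx v w
    rw [hgi]
    exact (inCoordinates_apply_eq₂ (E₃ := Bundle.Trivial M₁ ℝ) hx hx (by simp)).trans (by simp; rfl)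
  have hsaddle : ∀ x ∈ t.baseSet, F x ∈ t₂.baseSet →
      (saddleOperator (G x) (A x)).IsInvertible ∧ (t ⟨x, hProj E₂ F x (X x)⟩).2 =
        ((saddleOperator (G x) (A x)).inverse (0, A x (t ⟨x, X x⟩).2)).1 := by
    intro x hx hFx
    let e := t.continuousLinearEquivAt ℝ x hx
    let e₂ := t₂.continuousLinearEquivAt ℝ (F x) hFx
    have hAapp : ∀ v, A x v = e₂ (mfderiv 𝓘(ℝ, E₁) 𝓘(ℝ, E₂) F x (e.symm v)) := fun v ↦
      DFunLike.congr_fun (ContinuousLinearMap.inCoordinates_eq hx hFx) v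
    have hGe : ∀ v w : E₁, G x v w = inner ℝ (e.symm v) (e.symm w) := hGapp x hx
    have hinv : (saddleOperator (G x) (A x)).IsInvertible := by
      refine isInvertible_saddleOperator (fun v hv ↦ ?_) fun w ↦ ?_
      · rw [hGe]
        exact real_inner_self_pos.2 (e.symm.map_ne_zero_iff.2 hv)
      · obtain ⟨v, hv⟩ := hsurj x (e₂.symm w)
        exact ⟨e v, by rw [hAapp, e.symm_apply_apply, hv, e₂.apply_symm_apply]⟩
    refine ⟨hinv, ?_⟩
    have hp := hinv.self_apply_inverse (0, A x (t ⟨x, X x⟩).2)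
    set p := (saddleOperator (G x) (A x)).inverse (0, A x (t ⟨x, X x⟩).2)
    rw [saddleOperator_apply, Prod.mk.injEq] at hp
    obtain ⟨hp₁, hp₂⟩ := hp
    have hker : ∀ v, A x v = 0 ↔ e.symm v ∈ vertical E₁ E₂ F x := fun v ↦ by
      rw [hAapp, e₂.map_eq_zero_iff]
      rfl
    have heX : e (X x) = (t ⟨x, X x⟩).2 := rfl
    have hproj : hProj E₂ F x (X x) = e.symm p.1 := by
      refine Submodule.eq_starProjection_of_mem_orthogonal (K := horizontal E₁ E₂ F x) ?_ ?_
      -- On vertical vectors the multiplier term vanishes, so the first saddle equation says that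
      -- the solution is orthogonal to them.
      · refine (Submodule.mem_orthogonal' _ _).2 fun u hu ↦ ?_
        have hu' : A x (e u) = 0 := (hker _).2 (by rwa [e.symm_apply_apply])
        have := DFunLike.congr_fun hp₁ (e u)
        simpa [hGe, hu'] using this
      -- By the second saddle equation, the solution and `X x` have the same image under the
      -- differential, so they differ by a vertical vector.
      · refine Submodule.le_orthogonal_orthogonal _ ?_
        rw [← e.symm_apply_apply (X x), ← map_sub, ← hker, map_sub, hp₂, heX, sub_self]
    rw [hproj]
    exact e.apply_symm_apply p.1
  have hx₀ : x₀ ∈ t.baseSet := FiberBundle.mem_baseSet_trivializationAt' x₀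
  have hFx₀ : F x₀ ∈ t₂.baseSet := FiberBundle.mem_baseSet_trivializationAt' (F x₀)
  -- Inversion is smooth near an invertible operator, and the saddle operator depends smoothly on
  -- its coefficients.
  have hL : ContMDiffAt 𝓘(ℝ, E₁) 𝓘(ℝ, (E₁ →L[ℝ] ℝ) × E₂ →L[ℝ] E₁ × (E₂ →L[ℝ] ℝ)) ∞
      (fun x ↦ (saddleOperator (G x) (A x)).inverse) x₀ :=
    (((hsaddle x₀ hx₀ hFx₀).1.contDiffAt_map_inverse.comp (G x₀, A x₀)
      contDiff_saddleOperator.contDiffAt).contMDiffAt).comp x₀ (hG.prodMk_space hA)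
  have hR : ContMDiffAt 𝓘(ℝ, E₁) 𝓘(ℝ, (E₁ →L[ℝ] ℝ) × E₂) ∞
      (fun x ↦ ((0 : E₁ →L[ℝ] ℝ), A x (t ⟨x, X x⟩).2)) x₀ :=
    contMDiffAt_const.prodMk_space (hA.clm_apply hXx)
  refine (contDiff_fst.contDiffAt.contMDiffAt.comp x₀ (hL.clm_apply hR)).congr_of_eventuallyEq ?_
  filter_upwards [t.open_baseSet.mem_nhds hx₀,
    hF.continuous.continuousAt.preimage_mem_nhds (t₂.open_baseSet.mem_nhds hFx₀)] with x hx hFx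
  exact (hsaddle x hx hFx).2

end HorizontalProjection

/-! ### The operators ℬ and 𝒞, O'Neill's tensor and the Kähler condition -/

section Decomposition

set_option linter.unusedSectionVars false

variable {E₁ E₂ : Type*} [NormedAddCommGroup E₁] [NormedSpace ℝ E₁] [FiniteDimensional ℝ E₁]
  [NormedAddCommGroup E₂] [NormedSpace ℝ E₂]
  {M₁ M₂ : Type*} [TopologicalSpace M₁] [ChartedSpace E₁ M₁] [IsManifold 𝓘(ℝ, E₁) ∞ M₁]
  [TopologicalSpace M₂] [ChartedSpace E₂ M₂] [IsManifold 𝓘(ℝ, E₂) ∞ M₂]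
  [RiemannianBundle (fun x : M₁ ↦ TangentSpace 𝓘(ℝ, E₁) x)]
  [IsContMDiffRiemannianBundle 𝓘(ℝ, E₁) ∞ E₁ (fun x : M₁ ↦ TangentSpace 𝓘(ℝ, E₁) x)]
  [RiemannianBundle (fun x : M₂ ↦ TangentSpace 𝓘(ℝ, E₂) x)]
  {J : Π x : M₁, TangentSpace 𝓘(ℝ, E₁) x →L[ℝ] TangentSpace 𝓘(ℝ, E₁) x} {F : M₁ → M₂}
  {D₁ : Π x : M₁, Submodule ℝ (TangentSpace 𝓘(ℝ, E₁) x)}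

theorem IsSmoothField.mdiffAt {X : Π x : M₁, TangentSpace 𝓘(ℝ, E₁) x} (hX : IsSmoothField X)
    (x : M₁) : MDiffAt (T% X) x :=
  (hX x).mdifferentiableAt (by simp)

theorem IsAlmostHermitian.isSmoothField_map (hJ : IsAlmostHermitian J)
    {X : Π x : M₁, TangentSpace 𝓘(ℝ, E₁) x} (hX : IsSmoothField X) :
    IsSmoothField (fun x ↦ J x (X x)) :=
  ContMDiff.clm_bundle_apply (F₁ := E₁) (F₂ := E₁) hJ.smooth hX

theorem vProj_add_hProj (x : M₁) (v : TangentSpace 𝓘(ℝ, E₁) x) :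
    vProj E₂ F x v + hProj E₂ F x v = v :=
  Submodule.starProjection_add_starProjection_orthogonal v

theorem vProj_mem (x : M₁) (v : TangentSpace 𝓘(ℝ, E₁) x) : vProj E₂ F x v ∈ vertical E₁ E₂ F x :=
  Submodule.starProjection_apply_mem _ v

theorem hProj_mem (x : M₁) (v : TangentSpace 𝓘(ℝ, E₁) x) :
    hProj E₂ F x v ∈ horizontal E₁ E₂ F x :=
  Submodule.starProjection_apply_mem _ v

theorem vProj_eq_self {x : M₁} {v : TangentSpace 𝓘(ℝ, E₁) x} (hv : v ∈ vertical E₁ E₂ F x) :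
    vProj E₂ F x v = v :=
  Submodule.starProjection_eq_self_iff.2 hv

theorem hProj_eq_self {x : M₁} {v : TangentSpace 𝓘(ℝ, E₁) x} (hv : v ∈ horizontal E₁ E₂ F x) :
    hProj E₂ F x v = v :=
  Submodule.starProjection_eq_self_iff.2 hv

theorem vProj_eq_zero {x : M₁} {v : TangentSpace 𝓘(ℝ, E₁) x} (hv : v ∈ horizontal E₁ E₂ F x) :
    vProj E₂ F x v = 0 := by
  simpa [hProj_eq_self hv] using vProj_add_hProj (E₂ := E₂) (F := F) x v

theorem hProj_eq_zero {x : M₁} {v : TangentSpace 𝓘(ℝ, E₁) x} (hv : v ∈ vertical E₁ E₂ F x) :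
    hProj E₂ F x v = 0 := by
  simpa [vProj_eq_self hv] using vProj_add_hProj (E₂ := E₂) (F := F) x v

theorem fieldB_mem (Z : Π x : M₁, TangentSpace 𝓘(ℝ, E₁) x) (x : M₁) :
    fieldB E₂ J F D₁ Z x ∈ distD₂ E₂ F D₁ x :=
  Submodule.starProjection_apply_mem _ _

theorem fieldC_mem (Z : Π x : M₁, TangentSpace 𝓘(ℝ, E₁) x) (x : M₁) :
    fieldC E₂ J F D₁ Z x ∈ distμ E₂ J F D₁ x :=
  Submodule.starProjection_apply_mem _ _

/-- On horizontal vector fields, `𝒞` is the horizontal part of `J`. -/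
theorem fieldC_eq_hProj (hJ : IsAlmostHermitian J) (hF : IsSemiInvariantSubmersion E₂ J F D₁)
    {Z : Π x : M₁, TangentSpace 𝓘(ℝ, E₁) x} {x : M₁} (hZ : Z x ∈ horizontal E₁ E₂ F x) :
    fieldC E₂ J F D₁ Z x = hProj E₂ F x (J x (Z x)) := by
  rw [map_eq_fieldB_add_fieldC hJ hF hZ, map_add, hProj_eq_zero (fieldB_mem Z x).1,
    hProj_eq_self (fieldC_mem Z x).1, zero_add]

/-- Smoothness is not visible from the projection onto μ; it comes from 𝒞 = ℋJ on horizontal fields.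
-/
theorem fieldC_mem_smoothSections [FiniteDimensional ℝ E₂] (hJ : IsAlmostHermitian J)
    (hF : IsSemiInvariantSubmersion E₂ J F D₁) {Z : Π x : M₁, TangentSpace 𝓘(ℝ, E₁) x}
    (hZ : Z ∈ smoothSections (horizontal E₁ E₂ F)) :
    fieldC E₂ J F D₁ Z ∈ smoothSections (horizontal E₁ E₂ F) := by
  refine ⟨?_, fun x ↦ (fieldC_mem Z x).1⟩
  rw [show fieldC E₂ J F D₁ Z = fun x ↦ hProj E₂ F x (J x (Z x)) from
    funext fun x ↦ fieldC_eq_hProj hJ hF (hZ.2 x)]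
  exact isSmoothField_hProj hF.smooth hF.surjective_mfderiv (hJ.isSmoothField_map hZ.1)

theorem isSmoothField_fieldB [FiniteDimensional ℝ E₂] (hJ : IsAlmostHermitian J)
    (hF : IsSemiInvariantSubmersion E₂ J F D₁) {Z : Π x : M₁, TangentSpace 𝓘(ℝ, E₁) x}
    (hZ : Z ∈ smoothSections (horizontal E₁ E₂ F)) : IsSmoothField (fieldB E₂ J F D₁ Z) := by
  have h : fieldB E₂ J F D₁ Z = (fun x ↦ J x (Z x)) - fieldC E₂ J F D₁ Z :=
    funext fun x ↦ eq_sub_of_add_eq (map_eq_fieldB_add_fieldC hJ hF (hZ.2 x)).symm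
  rw [h]
  exact ContMDiff.sub_section (hJ.isSmoothField_map hZ.1) (fieldC_mem_smoothSections hJ hF hZ).1

/-- `𝒞² Z = -Z - Jℬ Z` for horizontal `Z`. -/
theorem fieldC_fieldC (hJ : IsAlmostHermitian J) (hF : IsSemiInvariantSubmersion E₂ J F D₁)
    {Z : Π x : M₁, TangentSpace 𝓘(ℝ, E₁) x} {x : M₁} (hZ : Z x ∈ horizontal E₁ E₂ F x) :
    fieldC E₂ J F D₁ (fieldC E₂ J F D₁ Z) x = -Z x - J x (fieldB E₂ J F D₁ Z x) := by
  have h : J x (fieldC E₂ J F D₁ Z x) = -Z x - J x (fieldB E₂ J F D₁ Z x) := by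
    rw [← hJ.sq_eq_neg x (Z x), map_eq_fieldB_add_fieldC hJ hF hZ, map_add, add_sub_cancel_left]
  rw [fieldC_eq_hProj hJ hF (fieldC_mem Z x).1, h, hProj_eq_self]
  exact Submodule.sub_mem _ (Submodule.neg_mem _ hZ)
    (hF.map_D₂_le x (Submodule.mem_map_of_mem (fieldB_mem Z x)))

/-- Z + 𝒞²Z = -JℬZ is the J𝒟₂ component of Z; J sends it to ℬZ, which is vertical and so has no 𝒞
part. -/
theorem fieldC_add_fieldC_fieldC (hJ : IsAlmostHermitian J)
    (hF : IsSemiInvariantSubmersion E₂ J F D₁) {Z : Π x : M₁, TangentSpace 𝓘(ℝ, E₁) x}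
    (hZ : ∀ x, Z x ∈ horizontal E₁ E₂ F x) :
    fieldC E₂ J F D₁ (Z + fieldC E₂ J F D₁ (fieldC E₂ J F D₁ Z)) = 0 := by
  funext x
  have hC : fieldC E₂ J F D₁ (fieldC E₂ J F D₁ Z) x ∈ horizontal E₁ E₂ F x := (fieldC_mem _ x).1
  rw [fieldC_eq_hProj hJ hF (Submodule.add_mem _ (hZ x) hC), Pi.add_apply,
    fieldC_fieldC hJ hF (hZ x)]
  simp [hJ.sq_eq_neg, hProj_eq_zero (fieldB_mem Z x).1]

theorem leviCivita_add {Y Y' : Π x : M₁, TangentSpace 𝓘(ℝ, E₁) x} (hY : IsSmoothField Y)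
    (hY' : IsSmoothField Y') (x : M₁) :
    leviCivita (Y + Y') x = leviCivita Y x + leviCivita Y' x :=
  leviCivita.isCovariantDerivativeOnUniv.add (hY.mdiffAt x) (hY'.mdiffAt x)

/-- One of the two projected fields is identically zero. Since `Y` is differentiated, verticality is
needed at every point, whereas `X` enters only through its value at `x`. -/
theorem oneillA_of_vertical {X Y : Π x : M₁, TangentSpace 𝓘(ℝ, E₁) x} {x : M₁}
    (hX : X x ∈ horizontal E₁ E₂ F x) (hY : ∀ y, Y y ∈ vertical E₁ E₂ F y) :
    oneillA E₂ F X Y x = hProj E₂ F x (leviCivita Y x (X x)) := by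
  have h₁ : (fun y ↦ vProj E₂ F y (Y y)) = Y := funext fun y ↦ vProj_eq_self (hY y)
  have h₂ : (fun y ↦ hProj E₂ F y (Y y)) = 0 := funext fun y ↦ hProj_eq_zero (hY y)
  simp [oneillA, h₁, h₂, hProj_eq_self hX, CovariantDerivative.zero]

theorem oneillA_of_horizontal {X Y : Π x : M₁, TangentSpace 𝓘(ℝ, E₁) x} {x : M₁}
    (hX : X x ∈ horizontal E₁ E₂ F x) (hY : ∀ y, Y y ∈ horizontal E₁ E₂ F y) :
    oneillA E₂ F X Y x = vProj E₂ F x (leviCivita Y x (X x)) := by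
  have h₁ : (fun y ↦ vProj E₂ F y (Y y)) = 0 := funext fun y ↦ vProj_eq_zero (hY y)
  have h₂ : (fun y ↦ hProj E₂ F y (Y y)) = Y := funext fun y ↦ hProj_eq_self (hY y)
  simp [oneillA, h₁, h₂, hProj_eq_self hX, CovariantDerivative.zero]

/-- On a Kähler manifold, `𝒜_{Z₁} ℬZ₂ + ℋ ∇_{Z₁} 𝒞Z₂` is the horizontal part of `J ∇_{Z₁} Z₂`. -/
theorem oneillA_fieldB_add_hProj [FiniteDimensional ℝ E₂] (hJ : IsKahler J)
    (hF : IsSemiInvariantSubmersion E₂ J F D₁) {Z₁ Z₂ : Π x : M₁, TangentSpace 𝓘(ℝ, E₁) x}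
    (hZ₁ : Z₁ ∈ smoothSections (horizontal E₁ E₂ F))
    (hZ₂ : Z₂ ∈ smoothSections (horizontal E₁ E₂ F)) (x : M₁) :
    oneillA E₂ F Z₁ (fieldB E₂ J F D₁ Z₂) x
        + hProj E₂ F x (leviCivita (fieldC E₂ J F D₁ Z₂) x (Z₁ x)) =
      hProj E₂ F x (J x (leviCivita Z₂ x (Z₁ x))) := by
  have hJZ : (fun y ↦ J y (Z₂ y)) = fieldB E₂ J F D₁ Z₂ + fieldC E₂ J F D₁ Z₂ :=
    funext fun y ↦ map_eq_fieldB_add_fieldC hJ.toIsAlmostHermitian hF (hZ₂.2 y)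
  -- Since ∇J = 0, J∇_{Z₁}Z₂ = ∇_{Z₁}(JZ₂), and JZ₂ splits as ℬZ₂ + 𝒞Z₂.
  rw [← sub_eq_zero.1 (hJ.parallel Z₁ Z₂ hZ₁.1 hZ₂.1 x), hJZ,
    leviCivita_add (isSmoothField_fieldB hJ.toIsAlmostHermitian hF hZ₂)
      (fieldC_mem_smoothSections hJ.toIsAlmostHermitian hF hZ₂).1,
    oneillA_of_vertical (hZ₁.2 x) fun y ↦ (fieldB_mem Z₂ y).1, add_apply, map_add]

/-- The horizontal part of `J v` lies in `μ` if and only if `v` is orthogonal to `𝒟₂`. -/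
theorem hProj_map_mem_distμ_iff (hJ : IsAlmostHermitian J)
    (hF : IsSemiInvariantSubmersion E₂ J F D₁) {x : M₁} (v : TangentSpace 𝓘(ℝ, E₁) x) :
    hProj E₂ F x (J x v) ∈ distμ E₂ J F D₁ x ↔ v ∈ (distD₂ E₂ F D₁ x)ᗮ := by
  -- `J d` is horizontal, so the vertical part of `J v` does not contribute to the inner product;
  -- then J is an isometry.
  have hinner : ∀ d ∈ distD₂ E₂ F D₁ x,
      inner ℝ (hProj E₂ F x (J x v)) (J x d) = inner ℝ v d := by
    intro d hd
    have hd' : J x d ∈ horizontal E₁ E₂ F x := hF.map_D₂_le x (Submodule.mem_map_of_mem hd)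
    rw [← hJ.inner_map_map x v d, ← vProj_add_hProj (E₂ := E₂) (F := F) x (J x v),
      inner_add_left, Submodule.inner_right_of_mem_orthogonal (vProj_mem x _) hd', zero_add,
      map_add, hProj_eq_zero (vProj_mem x _), hProj_eq_self (hProj_mem x _), zero_add]
  refine ⟨fun h ↦ (Submodule.mem_orthogonal' _ _).2 fun d hd ↦ ?_,
    fun h ↦ ⟨hProj_mem x _, (Submodule.mem_orthogonal' _ _).2 ?_⟩⟩
  · rw [← hinner d hd]
    exact Submodule.inner_left_of_mem_orthogonal (Submodule.mem_map_of_mem hd) h.2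
  · rintro _ ⟨d, hd, rfl⟩
    exact (hinner d hd).trans (Submodule.inner_left_of_mem_orthogonal hd h)

/-- The horizontal distribution defines a totally geodesic foliation as soon as covariant
derivatives of horizontal fields along horizontal fields are horizontal: the Levi-Civita connection
is torsion free. -/
theorem isTotallyGeodesicFoliation_horizontal_iff :
    IsTotallyGeodesicFoliation (horizontal E₁ E₂ F) ↔
      ∀ Z₁ ∈ smoothSections (horizontal E₁ E₂ F), ∀ Z₂ ∈ smoothSections (horizontal E₁ E₂ F),
        ∀ x, vProj E₂ F x (leviCivita Z₂ x (Z₁ x)) = 0 := by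
  have hsff : ∀ Z₁ Z₂ x, secondFundamentalForm (horizontal E₁ E₂ F) Z₁ Z₂ x =
      vProj E₂ F x (leviCivita Z₂ x (Z₁ x)) := fun Z₁ Z₂ x ↦ by
    -- The normal space to the horizontal distribution is the double orthogonal complement of the
    -- vertical space, hence the vertical space itself.
    simp only [secondFundamentalForm, horizontal, vProj, Submodule.orthogonal_orthogonal]
  refine ⟨fun h Z₁ hZ₁ Z₂ hZ₂ x ↦ (hsff Z₁ Z₂ x).symm.trans (h.totallyGeodesic Z₁ hZ₁ Z₂ hZ₂ x),
    fun h ↦ ⟨fun X hX Y hY x ↦ ?_, fun Z₁ hZ₁ Z₂ hZ₂ x ↦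
      (hsff Z₁ Z₂ x).trans (h Z₁ hZ₁ Z₂ hZ₂ x)⟩⟩
  have hmem : ∀ v : TangentSpace 𝓘(ℝ, E₁) x, vProj E₂ F x v = 0 → v ∈ horizontal E₁ E₂ F x :=
    fun v hv ↦ by
      rw [← vProj_add_hProj (E₂ := E₂) (F := F) x v, hv, zero_add]
      exact hProj_mem x v
  rw [← leviCivita_torsion (hX.1.mdiffAt x) (hY.1.mdiffAt x)]
  exact Submodule.sub_mem _ (hmem _ (h X hX Y hY x)) (hmem _ (h Y hY X hX x))

end Decomposition
-- The equivalence
theorem proposition3p5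
    {E₁ E₂ : Type*} [NormedAddCommGroup E₁] [NormedSpace ℝ E₁] [FiniteDimensional ℝ E₁]
    [NormedAddCommGroup E₂] [NormedSpace ℝ E₂] [FiniteDimensional ℝ E₂]
    {M₁ M₂ : Type*}
    [TopologicalSpace M₁] [T2Space M₁] [ChartedSpace E₁ M₁] [IsManifold 𝓘(ℝ, E₁) ∞ M₁]
    [RiemannianBundle (fun x : M₁ ↦ TangentSpace 𝓘(ℝ, E₁) x)]
    [IsContMDiffRiemannianBundle 𝓘(ℝ, E₁) ∞ E₁ (fun x : M₁ ↦ TangentSpace 𝓘(ℝ, E₁) x)]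
    [TopologicalSpace M₂] [T2Space M₂] [ChartedSpace E₂ M₂] [IsManifold 𝓘(ℝ, E₂) ∞ M₂]
    [RiemannianBundle (fun x : M₂ ↦ TangentSpace 𝓘(ℝ, E₂) x)]
    [IsContMDiffRiemannianBundle 𝓘(ℝ, E₂) ∞ E₂ (fun x : M₂ ↦ TangentSpace 𝓘(ℝ, E₂) x)]
    (J : Π x : M₁, TangentSpace 𝓘(ℝ, E₁) x →L[ℝ] TangentSpace 𝓘(ℝ, E₁) x)
    (hJ : IsKahler J)
    (F : M₁ → M₂)
    (D₁ : Π x : M₁, Submodule ℝ (TangentSpace 𝓘(ℝ, E₁) x))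
    (hF : IsSemiInvariantSubmersion E₂ J F D₁) :
    IsTotallyGeodesicFoliation (horizontal E₁ E₂ F) ↔
      ∀ Z₁ ∈ smoothSections (horizontal E₁ E₂ F), ∀ Z₂ ∈ smoothSections (horizontal E₁ E₂ F),
        (∀ x, oneillA E₂ F Z₁ (fieldB E₂ J F D₁ Z₂) x
            + hProj E₂ F x (leviCivita (fieldC E₂ J F D₁ Z₂) x (Z₁ x)) ∈ distμ E₂ J F D₁ x) ∧
        (∀ x, oneillA E₂ F Z₁ (fieldC E₂ J F D₁ Z₂) x
            + vProj E₂ F x (leviCivita Z₂ x (Z₁ x)) ∈ distD₂ E₂ F D₁ x) := by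
  have hH := hJ.toIsAlmostHermitian
  rw [isTotallyGeodesicFoliation_horizontal_iff]
  have hC : ∀ {Z}, Z ∈ smoothSections (horizontal E₁ E₂ F) →
      fieldC E₂ J F D₁ Z ∈ smoothSections (horizontal E₁ E₂ F) :=
    fun hZ ↦ fieldC_mem_smoothSections hH hF hZ
  constructor
  · intro h Z₁ hZ₁ Z₂ hZ₂
    refine ⟨fun x ↦ ?_, fun x ↦ ?_⟩
    · rw [oneillA_fieldB_add_hProj hJ hF hZ₁ hZ₂, hProj_map_mem_distμ_iff hH hF]
      -- Since 𝒟₂ is vertical, it suffices that the covariant derivative is horizontal.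
      refine Submodule.orthogonal_le inf_le_left ?_
      rw [← vProj_add_hProj (E₂ := E₂) (F := F) x (leviCivita Z₂ x (Z₁ x)), h Z₁ hZ₁ Z₂ hZ₂,
        zero_add]
      exact hProj_mem x _
    · rw [oneillA_of_horizontal (hZ₁.2 x) (hC hZ₂).2, h Z₁ hZ₁ _ (hC hZ₂), h Z₁ hZ₁ Z₂ hZ₂,
        add_zero]
      exact Submodule.zero_mem _
  · intro h Z₁ hZ₁ Z₂ hZ₂ x
    let f : (Π x : M₁, TangentSpace 𝓘(ℝ, E₁) x) → TangentSpace 𝓘(ℝ, E₁) x :=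
      fun Y ↦ vProj E₂ F x (leviCivita Y x (Z₁ x))
    have hf : ∀ Z ∈ smoothSections (horizontal E₁ E₂ F),
        f (fieldC E₂ J F D₁ Z) + f Z ∈ distD₂ E₂ F D₁ x := by
      intro Z hZ
      have := (h Z₁ hZ₁ Z hZ).2 x
      rwa [oneillA_of_horizontal (hZ₁.2 x) (hC hZ).2] at this
    have hCC := hC (hC hZ₂)
    -- The test field Q = Z₂ + 𝒞²Z₂ is chosen because 𝒞Q = 0: the second condition for Q then reads
    -- f(Q) ∈ 𝒟₂.
    have hQ : Z₂ + fieldC E₂ J F D₁ (fieldC E₂ J F D₁ Z₂) ∈ smoothSections (horizontal E₁ E₂ F) :=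
      ⟨ContMDiff.add_section hZ₂.1 hCC.1, fun y ↦ Submodule.add_mem _ (hZ₂.2 y) (hCC.2 y)⟩
    have hfQ := hf _ hQ
    have hf₀ : f 0 = 0 := by simp [f, CovariantDerivative.zero]
    have hfadd : f (Z₂ + fieldC E₂ J F D₁ (fieldC E₂ J F D₁ Z₂)) =
        f Z₂ + f (fieldC E₂ J F D₁ (fieldC E₂ J F D₁ Z₂)) := by
      simp only [f, leviCivita_add hZ₂.1 hCC.1, add_apply, map_add]
    rw [fieldC_add_fieldC_fieldC hH hF hZ₂.2, hf₀, zero_add, hfadd] at hfQ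
    have hmem : f Z₂ ∈ distD₂ E₂ F D₁ x := by
      -- Combines the second condition for Z₂, for 𝒞Z₂ (subtracted) and for Q; the sum is 2f(Z₂).
      have h₂ : f Z₂ = (1 / 2 : ℝ) • ((f (fieldC E₂ J F D₁ Z₂) + f Z₂)
          - (f (fieldC E₂ J F D₁ (fieldC E₂ J F D₁ Z₂)) + f (fieldC E₂ J F D₁ Z₂))
          + (f Z₂ + f (fieldC E₂ J F D₁ (fieldC E₂ J F D₁ Z₂)))) := by module
      rw [h₂]
      exact Submodule.smul_mem _ _
        (Submodule.add_mem _ (Submodule.sub_mem _ (hf _ hZ₂) (hf _ (hC hZ₂))) hfQ)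
    have horth : f Z₂ ∈ (distD₂ E₂ F D₁ x)ᗮ := by
      have h₁ := (h Z₁ hZ₁ Z₂ hZ₂).1 x
      rw [oneillA_fieldB_add_hProj hJ hF hZ₁ hZ₂, hProj_map_mem_distμ_iff hH hF] at h₁
      -- The first condition makes the full derivative orthogonal to 𝒟₂; removing its horizontal
      -- part, also orthogonal to 𝒟₂, leaves f(Z₂).
      have h₂ : f Z₂ = leviCivita Z₂ x (Z₁ x) - hProj E₂ F x (leviCivita Z₂ x (Z₁ x)) :=
        eq_sub_of_add_eq (vProj_add_hProj x _)
      rw [h₂]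
      exact Submodule.sub_mem _ h₁ (Submodule.orthogonal_le inf_le_left (hProj_mem x _))
    exact inner_self_eq_zero.1 (Submodule.inner_right_of_mem_orthogonal hmem horth)
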